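/- **Conventions.** All topological abelian groups below have linear topology (open subgroups form a base of neighborhoods of zero). Such a group $A$ is *complete and separated* if the natural map $A\to\varprojlim_U A/U$, with $U$ ranging over the open subgroups, is bijective. A family in $A$ *converges to zero* if each neighborhood of zero contains all but finitely many of its members. A closed subgroup $H\subset A$ is *strongly closed* if $A/H$ is complete in the quotient topology and every family of elements of $A/H$ (indexed by any set) converging to zero lifts to a family of elements of $A$ converging to zero. A complete, separated topological ring is *right linear* if open right ideals form a base of neighborhoods of zero; such a ring $S$ is *topologically semisimple* if the abelian category of discrete right $S$-modules (right modules in which the annihilator of every element is open in $S$) is semisimple. An additive category $\mathsf A$ with set-indexed coproducts is *agreeable* if the natural map $\operatorname{Hom}(M,\coprod_x N_x)\to\prod_x\operatorname{Hom}(M,N_x)$ is injective for every object $M$ and every family $(N_x)$; a family of morphisms $M\to N_x$ is then *summable* if it arises from a morphism $M\to\coprod_x N_x$. An agreeable category is *topologically agreeable* if its groups of morphisms carry complete, separated topologies such that the composition maps are continuous, open $\operatorname{End}(N)$-submodules form a base of neighborhoods of zero in $\operatorname{Hom}(M,N)$ for all $M,N$, and every summable family of morphisms $M\to N$ converges to zero.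 **Proposition.** Let $\mathsf A$ be a topologically agreeable category and let $M=\coprod_{z\in Z}M_z$ be an object of $\mathsf A$ decomposed into a coproduct, indexed by a set $Z$, of objects $M_z$ with local endomorphism rings. Put $\mathfrak R=\operatorname{End}_{\mathsf A}(M)^{\mathrm{op}}$, with its given topology. Assigning to $r\in\mathfrak R$ the matrix of its components $r_{w,z}\colon M_w\to M_z$ identifies $\mathfrak R$ bijectively with the set of all row-summable matrices, that is, matrices $(r_{w,z})_{w,z\in Z}$ of morphisms $r_{w,z}\colon M_w\to M_z$ such that for each $w$ the family $(r_{w,z})_{z\in Z}$ is summable. Let $\mathfrak H'\subset\mathfrak R$ be the set of all elements whose matrices $(h_{w,z})$ are such that $h_{w,z}$ is not an isomorphism for all $w,z\in Z$. Then: 1. $\mathfrak H'$ is a strongly closed two-sided ideal of $\mathfrak R$. 2. The quotient ring $\mathfrak S=\mathfrak R/\mathfrak H'$, with the quotient topology, is a complete, separated, right linear topological ring, and it is topologically semisimple. 3. For every $z\in Z$ the quotient $D_z$ of $\operatorname{End}_{\mathsf A}(M_z)^{\mathrm{op}}$ by its Jacobson radical is a skew-field. Let $X$ be the set of isomorphism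 classes of the objects $M_z$, let $Y_x\subset Z$ be the set of all $z$ with $M_z$ in the class $x\in X$, and let $D_x=D_z$ for a chosen $z\in Y_x$. Then $\mathfrak S$ is isomorphic, as a topological ring, to the product $\prod_{x\in X}\mathfrak{Mat}_{Y_x}(D_x)$, with the product topology, of the rings of row-finite $Y_x\times Y_x$ matrices with entries in $D_x$, where a base of neighborhoods of zero in $\mathfrak{Mat}_{Y}(D)$ is formed by the sets of matrices vanishing in a given finite set of rows. -/

import Mathlib

open CategoryTheory CategoryTheory.Limits Filter Topology MulOpposite

universe v u

noncomputable section

/-! ## Topological abelian groups with linear topology -/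

/-- A topological abelian group is separated if the completion map `A → lim A / U`, over all open
subgroups `U`, is injective. -/
def IsLinearlySeparated (A : Type v) [AddCommGroup A] [TopologicalSpace A] : Prop :=
  ∀ a : A, (∀ U : OpenAddSubgroup A, a ∈ U) → a = 0

/-- A topological abelian group is complete if the completion map `A → lim A / U`, over all open
subgroups `U`, is surjective: every compatible family of cosets `c U + U` is the family of
cosets of one element. -/
def IsLinearlyComplete (A : Type v) [AddCommGroup A] [TopologicalSpace A] : Prop :=
  ∀ c : OpenAddSubgroup A → A,
    (∀ U V : OpenAddSubgroup A, U ≤ V → c U - c V ∈ V) →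
      ∃ a : A, ∀ U : OpenAddSubgroup A, a - c U ∈ U

/-- A closed subgroup `H` of a topological abelian group `A` is strongly closed if `A ⧸ H` is
complete in the quotient topology and every family of elements of `A ⧸ H` converging to zero lifts
to a family of elements of `A` converging to zero. -/
structure IsStronglyClosed {A : Type v} [AddCommGroup A] [TopologicalSpace A]
    (H : AddSubgroup A) : Prop where
  isClosed : IsClosed (H : Set A)
  complete_quotient : IsLinearlyComplete (A ⧸ H)
  lift_family : ∀ (X : Type v) (q : X → A ⧸ H), Tendsto q cofinite (𝓝 0) →
    ∃ a : X → A, Tendsto a cofinite (𝓝 0) ∧ ∀ x, (QuotientAddGroup.mk (a x) : A ⧸ H) = q x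

/-! ## Topological rings -/

/-- Complete, separated, right linear topological rings (`Rᵐᵒᵖ`-submodules of `R` are right
ideals). -/
structure IsCompleteRightLinearRing (R : Type v) [Ring R] [TopologicalSpace R] : Prop where
  topologicalRing : IsTopologicalRing R
  rightLinear : IsLinearTopology Rᵐᵒᵖ R
  separated : IsLinearlySeparated R
  complete : IsLinearlyComplete R

/-- A right `S`-module is discrete if the annihilators of all its elements are open in `S`. -/
def IsDiscreteRightModule (S : Type v) [Ring S] [TopologicalSpace S]
    (M : Type v) [AddCommGroup M] [Module Sᵐᵒᵖ M] : Prop :=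
  ∀ m : M, IsOpen {s : S | op s • m = 0}

/-- A (complete, separated, right linear) topological ring `S` is topologically semisimple if the
abelian category of discrete right `S`-modules is semisimple. As submodules of discrete modules are
discrete, this says that every submodule of a discrete right module is a direct summand. -/
structure IsTopologicallySemisimple (S : Type v) [Ring S] [TopologicalSpace S] : Prop where
  completeRightLinear : IsCompleteRightLinearRing S
  semisimple : ∀ (M : Type v) [AddCommGroup M] [Module Sᵐᵒᵖ M],
    IsDiscreteRightModule S M → IsSemisimpleModule Sᵐᵒᵖ M

/-! ## Row-finite matrices -/

/-- Row-finite `Y`-sized matrices with entries in `D`: the entry at `(w, z)` of `A` is `A.row w z`,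
and every row `A.row w` has finite support. -/
@[ext]
structure RowFiniteMatrix (Y : Type v) (D : Type v) [Ring D] : Type v where
  row : Y → Y →₀ D

namespace RowFiniteMatrix

variable {Y D : Type v} [Ring D]

instance : Zero (RowFiniteMatrix Y D) := ⟨⟨0⟩⟩

instance : Add (RowFiniteMatrix Y D) := ⟨fun A B => ⟨A.row + B.row⟩⟩

instance : Neg (RowFiniteMatrix Y D) := ⟨fun A => ⟨-A.row⟩⟩

open Classical in
instance : One (RowFiniteMatrix Y D) := ⟨⟨fun w => Finsupp.single w 1⟩⟩

/-- The `w`-th row of the product `A * B` is `∑ y, A.row w y • B.row y`. -/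
instance : Mul (RowFiniteMatrix Y D) :=
  ⟨fun A B => ⟨fun w => Finsupp.linearCombination D B.row (A.row w)⟩⟩

theorem zero_row : (0 : RowFiniteMatrix Y D).row = 0 := rfl

theorem add_row (A B : RowFiniteMatrix Y D) : (A + B).row = A.row + B.row := rfl

theorem neg_row (A : RowFiniteMatrix Y D) : (-A).row = -A.row := rfl

theorem one_row (w : Y) : (1 : RowFiniteMatrix Y D).row w = Finsupp.single w 1 := by
  classical
  change Finsupp.single w 1 = _
  congr

theorem mul_row (A B : RowFiniteMatrix Y D) (w : Y) :
    (A * B).row w = Finsupp.linearCombination D B.row (A.row w) := rfl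

/-- The usual formula for the entries of a product of matrices. -/
theorem mul_entry (A B : RowFiniteMatrix Y D) (w z : Y) :
    (A * B).row w z = (A.row w).sum fun y a => a * B.row y z := by
  rw [mul_row, Finsupp.linearCombination_apply, Finsupp.sum_apply]
  rfl

theorem ext_row {A B : RowFiniteMatrix Y D} (h : ∀ w, A.row w = B.row w) : A = B :=
  RowFiniteMatrix.ext (funext h)

instance : Ring (RowFiniteMatrix Y D) :=
  Ring.ofMinimalAxioms
    (fun A B C => ext_row fun w => by simp [add_row, add_assoc])
    (fun A => ext_row fun w => by simp [add_row, zero_row])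
    (fun A => ext_row fun w => by simp [add_row, zero_row, neg_row])
    (fun A B C => ext_row fun w => by
      rw [mul_row, mul_row, mul_row, Finsupp.apply_linearCombination]
      rfl)
    (fun A => ext_row fun w => by simp [mul_row, one_row])
    (fun A => ext_row fun w => by
      rw [mul_row, Finsupp.linearCombination_apply]
      simp only [one_row, Finsupp.smul_single, smul_eq_mul, mul_one]
      exact Finsupp.sum_single _)
    (fun A B C => ext_row fun w => by
      simp [mul_row, add_row, Finsupp.linearCombination_apply, Finsupp.sum_add])
    (fun A B C => ext_row fun w => by simp [mul_row, add_row])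

/-- The finite topology of the ring of row-finite matrices over a discrete ring: the subspace
topology of the product, over all the rows, of the discrete groups of finite rows. A base of
neighbourhoods of zero is formed by the right ideals of matrices vanishing in a given finite set of
rows. -/
instance : TopologicalSpace (RowFiniteMatrix Y D) :=
  TopologicalSpace.induced RowFiniteMatrix.row
    (@Pi.topologicalSpace Y (fun _ => Y →₀ D) (fun _ => ⊥))

end RowFiniteMatrix

/-! ## Topologically agreeable categories -/

variable {C : Type u} [Category.{v} C] [Preadditive C]

open Classical in
/-- The projection of a coproduct of `N` in a preadditive category to the summand `N z`: it is the
identity on `N z` and zero on the other summands. -/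
def coproductProj {Z : Type v} {N : Z → C} {c : Cofan N} (hc : IsColimit c) (z : Z) :
    c.pt ⟶ N z :=
  Cofan.IsColimit.desc hc fun w => if h : w = z then eqToHom (congrArg N h) else 0

/-- A family of morphisms `f x : M ⟶ N x` is summable if it arises from a morphism
`M ⟶ ∐ N`. -/
def IsSummableFamily {X : Type v} {M : C} {N : X → C} (f : ∀ x, M ⟶ N x) : Prop :=
  ∃ (c : Cofan N) (hc : IsColimit c) (g : M ⟶ c.pt), ∀ x, g ≫ coproductProj hc x = f x

variable (C)

/-- An additive category with coproducts is agreeable if the maps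
`Hom(M, ∐ N) → ∏ x, Hom(M, N x)` are injective. -/
class IsAgreeable : Prop where
  hasCoproducts : HasCoproducts.{v} C
  injective : ∀ {X : Type v} {M : C} {N : X → C} {c : Cofan N} (hc : IsColimit c)
    (f g : M ⟶ c.pt), (∀ x, f ≫ coproductProj hc x = g ≫ coproductProj hc x) → f = g

/-- A (complete, separated) right topological additive category: the groups of morphisms carry
complete, separated linear topologies, the composition maps are continuous, and open
`End N`-submodules form a base of neighbourhoods of zero in `Hom(M, N)`. -/
class RightTopologicalCategory where
  homTopology : ∀ M N : C, TopologicalSpace (M ⟶ N)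
  homTopologicalAddGroup : ∀ M N : C, IsTopologicalAddGroup (M ⟶ N)
  homSeparated : ∀ M N : C, IsLinearlySeparated (M ⟶ N)
  homComplete : ∀ M N : C, IsLinearlyComplete (M ⟶ N)
  continuous_comp : ∀ L M N : C, Continuous fun p : (L ⟶ M) × (M ⟶ N) => p.1 ≫ p.2
  exists_open_submodule : ∀ (M N : C), ∀ U ∈ 𝓝 (0 : M ⟶ N), ∃ V : AddSubgroup (M ⟶ N),
    IsOpen (V : Set (M ⟶ N)) ∧ (V : Set (M ⟶ N)) ⊆ U ∧ ∀ f ∈ V, ∀ g : N ⟶ N, f ≫ g ∈ V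

attribute [reducible, instance] RightTopologicalCategory.homTopology

attribute [instance] RightTopologicalCategory.homTopologicalAddGroup

/-- A topologically agreeable category: a right topological agreeable category in which every
summable family of morphisms `M ⟶ N` converges to zero. -/
class IsTopologicallyAgreeable [RightTopologicalCategory C] : Prop extends IsAgreeable C where
  tendsto_zero : ∀ {X : Type v} {M N : C} (f : X → (M ⟶ N)),
    IsSummableFamily f → Tendsto f cofinite (𝓝 0)

variable {C}

instance [RightTopologicalCategory C] (M : C) : TopologicalSpace (End M) :=
  RightTopologicalCategory.homTopology M M

/-- The topological ring `End(M)ᵒᵖ`; it carries the topology of `Hom(M, M)`. -/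
abbrev EndOp (M : C) : Type v := (End M)ᵐᵒᵖ

/-- The quotient of `End(N)ᵒᵖ` by its Jacobson radical. When `End(N)` is local, this is its residue
skew-field. -/
abbrev ResidueRing (N : C) : Type v := EndOp N ⧸ Ring.jacobson (EndOp N)

/-! ## Matrices of endomorphisms of a coproduct -/

section Matrices

variable {Z : Type v} {N : Z → C} {c : Cofan N} (hc : IsColimit c)

/-- The entry `N w ⟶ N z` of the matrix of an endomorphism of the coproduct of `N`. -/
def matrixEntry (r : EndOp c.pt) (w z : Z) : N w ⟶ N z :=
  c.inj w ≫ (show c.pt ⟶ c.pt from r.unop) ≫ coproductProj hc z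

/-- A matrix of morphisms is row-summable if all its rows are summable families. -/
def IsRowSummable (r : ∀ w z : Z, N w ⟶ N z) : Prop :=
  ∀ w, IsSummableFamily (r w)

/-- The set of all endomorphisms of the coproduct all of whose matrix entries are
nonisomorphisms. -/
def nonisoMatrices : Set (EndOp c.pt) :=
  {h | ∀ w z, ¬ IsIso (matrixEntry hc h w z)}

end Matrices

/-- The equivalence relation on the index set: `w ∼ z` when `N w` and `N z` are isomorphic. -/
def isoSetoid {Z : Type v} (N : Z → C) : Setoid Z where
  r w z := Nonempty (N w ≅ N z)
  iseqv := ⟨fun _ => ⟨Iso.refl _⟩, fun ⟨e⟩ => ⟨e.symm⟩, fun ⟨e⟩ ⟨e'⟩ => ⟨e.trans e'⟩⟩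

/-- The set of isomorphism classes of the objects `N z`. -/
abbrev IsoClasses {Z : Type v} (N : Z → C) : Type v := Quotient (isoSetoid N)

/-- The set of all indices `z` with `N z` in the isomorphism class `x`. -/
abbrev IsoClassFiber {Z : Type v} (N : Z → C) (x : IsoClasses N) : Type v :=
  {z : Z // Quotient.mk (isoSetoid N) z = x}

end

/-! Between objects with local endomorphism rings, the nonisomorphisms are closed under sums and
under composition with arbitrary morphisms between such objects. They also form open subgroups
(`isOpen_nonisoSubgroup`). Since summable families converge to zero, each row of the matrix of an
endomorphism of the coproduct has only finitely many invertible entries (`finite_setOf_isIso`), all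
within one isomorphism class. Reducing entries modulo nonisomorphisms therefore gives row-finite
matrices over the residue skew-fields. The entries of a product are convergent infinite sums, but
modulo an open subgroup these become finite sums, so the reduction is a ring homomorphism φ
(`residueMatrix_mul`), with kernel the matrices of nonisomorphisms.

φ is continuous, and lifting residue classes entry by entry gives a section s, not additive but
tending to zero at zero. So φ is open and surjective, the quotient by its kernel is homeomorphic to
the product of matrix rings, and s lifts families converging to zero. Completeness is then checked
row by row.

Semisimplicity uses the projections e_w of the coproduct onto its summands: they sum to 1, and an
element of a discrete module multiplied by the image of e_w is zero or generates a simple submodule.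
-/

noncomputable section

/-! ## Morphisms between objects with local endomorphism rings -/

section LocalObjects

variable {C : Type u} [Category.{v} C]

/-- A morphism `A ⟶ A` as an element of the ring `End(A)ᵒᵖ`. -/
def EndOp.of {A : C} (f : A ⟶ A) : EndOp A := op f

/-- An element of the ring `End(A)ᵒᵖ` as a morphism `A ⟶ A`. -/
def EndOp.hom {A : C} (r : EndOp A) : A ⟶ A := r.unop

theorem EndOp.isUnit_of_iff {A : C} (f : A ⟶ A) : IsUnit (EndOp.of f) ↔ IsIso f :=
  isUnit_op.trans (CategoryTheory.isUnit_iff_isIso f)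

variable [Preadditive C]

theorem id_ne_zero_of_isLocalRing {A : C} (hA : IsLocalRing (EndOp A)) : 𝟙 A ≠ 0 := by
  intro h
  have h1 : (1 : EndOp A) = 0 := congrArg EndOp.of h
  exact one_ne_zero h1

theorem not_isIso_zero {A B : C} (hB : IsLocalRing (EndOp B)) : ¬ IsIso (0 : A ⟶ B) := by
  intro h
  apply id_ne_zero_of_isLocalRing hB
  rw [← IsIso.inv_hom_id (0 : A ⟶ B), comp_zero]

/-- Composing with the inverse of `f + g` turns the sum into a decomposition of 1 in a local ring.
-/
theorem not_isIso_add {A B : C} (hA : IsLocalRing (EndOp A)) {f g : A ⟶ B}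
    (hf : ¬ IsIso f) (hg : ¬ IsIso g) : ¬ IsIso (f + g) := by
  intro h
  have key : ∀ k : A ⟶ B, IsIso (k ≫ inv (f + g)) → IsIso k := fun k hk =>
    IsIso.of_isIso_comp_right k (inv (f + g))
  have h1 : EndOp.of (f ≫ inv (f + g)) + EndOp.of (g ≫ inv (f + g)) = 1 := by
    have : f ≫ inv (f + g) + g ≫ inv (f + g) = 𝟙 A := by
      rw [← Preadditive.add_comp, IsIso.hom_inv_id]
    exact congrArg EndOp.of this
  rcases hA.isUnit_or_isUnit_of_add_one h1 with h2 | h2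
  · exact hf (key f ((EndOp.isUnit_of_iff _).1 h2))
  · exact hg (key g ((EndOp.isUnit_of_iff _).1 h2))

/-- A right inverse `k` of `f` makes `k ≫ f` an idempotent of a local ring, hence 1 or 0. The value
0 would force `𝟙 A = 0`. -/
theorem isIso_left_of_isIso_comp {A B D : C} (hA : IsLocalRing (EndOp A))
    (hB : IsLocalRing (EndOp B)) (f : A ⟶ B) (g : B ⟶ D) (h : IsIso (f ≫ g)) : IsIso f := by
  set k : B ⟶ A := g ≫ inv (f ≫ g) with hk
  have hfk : f ≫ k = 𝟙 A := by rw [hk, ← Category.assoc, IsIso.hom_inv_id]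
  have hidem : (k ≫ f) ≫ (k ≫ f) = k ≫ f := by
    rw [Category.assoc, ← Category.assoc f k f, hfk, Category.id_comp]
  have h1 : EndOp.of (k ≫ f) + EndOp.of (𝟙 B - k ≫ f) = 1 := by
    have : k ≫ f + (𝟙 B - k ≫ f) = 𝟙 B := by abel
    exact congrArg EndOp.of this
  rcases hB.isUnit_or_isUnit_of_add_one h1 with h2 | h2
  · have := (EndOp.isUnit_of_iff _).1 h2
    refine ⟨k, hfk, ?_⟩
    rw [← cancel_epi (k ≫ f), hidem, Category.comp_id]
  · have := (EndOp.isUnit_of_iff _).1 h2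
    exfalso
    have h3 : k ≫ f = 0 := by
      rw [← cancel_epi (𝟙 B - k ≫ f), Preadditive.sub_comp, hidem, Category.id_comp, sub_self,
        comp_zero]
    apply id_ne_zero_of_isLocalRing hA
    rw [← Category.comp_id (𝟙 A), ← hfk, Category.assoc, ← Category.assoc k f k, h3]
    simp

theorem isIso_right_of_isIso_comp {A B D : C} (hA : IsLocalRing (EndOp A))
    (hB : IsLocalRing (EndOp B)) (f : A ⟶ B) (g : B ⟶ D) (h : IsIso (f ≫ g)) : IsIso g := by
  have := isIso_left_of_isIso_comp hA hB f g h
  exact IsIso.of_isIso_comp_left f g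

/-- The subgroup of nonisomorphisms between objects with local endomorphism rings. -/
def nonisoSubgroup {A B : C} (hA : IsLocalRing (EndOp A)) (hB : IsLocalRing (EndOp B)) :
    AddSubgroup (A ⟶ B) where
  carrier := {f | ¬ IsIso f}
  zero_mem' := not_isIso_zero hB
  add_mem' hf hg := not_isIso_add hA hf hg
  neg_mem' {f} hf h := hf (by
    have h' : IsIso (-f) := h
    exact ⟨-inv (-f), by
      have := IsIso.hom_inv_id (-f)
      rwa [Preadditive.neg_comp, ← Preadditive.comp_neg] at this, by
      have := IsIso.inv_hom_id (-f)
      rwa [Preadditive.comp_neg, ← Preadditive.neg_comp] at this⟩)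

theorem mem_nonisoSubgroup {A B : C} {hA : IsLocalRing (EndOp A)} {hB : IsLocalRing (EndOp B)}
    {f : A ⟶ B} : f ∈ nonisoSubgroup hA hB ↔ ¬ IsIso f := Iff.rfl

/-- By separatedness some open `End B`-submodule `V` omits a given isomorphism `u`. An isomorphism
`f` in `V` would give `u = f ≫ (inv f ≫ u) ∈ V`, so `V` consists of nonisomorphisms. -/
theorem isOpen_nonisoSubgroup [RightTopologicalCategory C] {A B : C}
    (hA : IsLocalRing (EndOp A)) (hB : IsLocalRing (EndOp B)) :
    IsOpen (nonisoSubgroup hA hB : Set (A ⟶ B)) := by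
  by_cases hu : ∃ u : A ⟶ B, IsIso u
  · obtain ⟨u, hu⟩ := hu
    have hu0 : u ≠ 0 := by
      rintro rfl
      exact not_isIso_zero hB hu
    obtain ⟨U, hU⟩ : ∃ U : OpenAddSubgroup (A ⟶ B), u ∉ U := by
      by_contra! h
      exact hu0 (RightTopologicalCategory.homSeparated A B u h)
    obtain ⟨V, hVo, hVU, hV⟩ := RightTopologicalCategory.exists_open_submodule A B U
      (U.isOpen.mem_nhds U.zero_mem)
    refine AddSubgroup.isOpen_mono (H₁ := V) (fun f hf hfi => hU ?_) hVo
    have hfi' : IsIso f := hfi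
    apply hVU
    have := hV f hf (inv f ≫ u)
    rwa [IsIso.hom_inv_id_assoc] at this
  · convert isOpen_univ
    ext f
    simp only [SetLike.mem_coe, mem_nonisoSubgroup, Set.mem_univ, iff_true]
    exact fun h => hu ⟨f, h⟩

end LocalObjects

/-! ## Sums of families converging to zero -/

section Sums

/-- Finite sums over sets containing `F` agree modulo `K` with the sum over `F`, and an open
subgroup is closed, so the limit does too. -/
theorem AddSubgroup.sub_sum_mem_of_hasSum {A ι : Type*} [AddCommGroup A] [TopologicalSpace A]
    [IsTopologicalAddGroup A] {f : ι → A} {a : A} (h : HasSum f a) (K : AddSubgroup A)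
    (hK : IsOpen (K : Set A)) (F : Finset ι) (hF : ∀ i ∉ F, f i ∈ K) :
    a - ∑ i ∈ F, f i ∈ K := by
  classical
  have hc : IsClosed (K : Set A) := K.isClosed_of_isOpen hK
  have ht : Tendsto (fun s : Finset ι => ∑ i ∈ s, f i - ∑ i ∈ F, f i) atTop
      (𝓝 (a - ∑ i ∈ F, f i)) := Filter.Tendsto.sub_const h _
  refine hc.mem_of_tendsto ht ?_
  filter_upwards [eventually_ge_atTop F] with s hs
  rw [← Finset.sum_sdiff hs, add_sub_cancel_right]
  exact K.sum_mem fun i hi => hF i (Finset.mem_sdiff.1 hi).2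

/-- For each open `U` only finitely many terms lie outside `U`; their sums form a compatible family
of cosets. -/
theorem IsLinearlyComplete.exists_hasSum {A ι : Type*} [AddCommGroup A] [TopologicalSpace A]
    [IsTopologicalAddGroup A] (hA : IsLinearlyComplete A)
    (hlin : ∀ U ∈ 𝓝 (0 : A), ∃ V : OpenAddSubgroup A, (V : Set A) ⊆ U)
    {f : ι → A} (hf : Tendsto f cofinite (𝓝 0)) : ∃ a, HasSum f a := by
  classical
  have hfin : ∀ U : OpenAddSubgroup A, {i | f i ∉ U}.Finite := fun U =>
    hf (U.isOpen.mem_nhds U.zero_mem)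
  have hmem : ∀ (U : OpenAddSubgroup A) (F : Finset ι), (hfin U).toFinset ⊆ F →
      ∑ i ∈ F, f i - ∑ i ∈ (hfin U).toFinset, f i ∈ U := by
    intro U F hF
    rw [← Finset.sum_sdiff hF, add_sub_cancel_right]
    refine sum_mem fun i hi => ?_
    by_contra h
    exact (Finset.mem_sdiff.1 hi).2 ((hfin U).mem_toFinset.2 h)
  obtain ⟨a, ha⟩ := hA (fun U => ∑ i ∈ (hfin U).toFinset, f i) (fun U V hUV => by
    refine hmem V _ fun i hi => ?_
    simp only [Set.Finite.mem_toFinset, Set.mem_ofPred_eq] at hi ⊢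
    exact fun h => hi (hUV h))
  refine ⟨a, ?_⟩
  have h0 : Tendsto (fun s : Finset ι => ∑ i ∈ s, f i - a) atTop (𝓝 0) := by
    intro U hU
    obtain ⟨V, hV⟩ := hlin U hU
    refine mem_map.2 (mem_of_superset (mem_atTop (hfin V).toFinset) fun s hs => hV ?_)
    have := V.sub_mem (hmem V s hs) (ha V)
    rwa [sub_sub_sub_cancel_right] at this
  have := h0.add_const a
  simpa [HasSum] using this

end Sums

/-! ## Coproducts in topologically agreeable categories -/

section Coproducts

variable {C : Type u} [Category.{v} C] [Preadditive C]
  {Z : Type v} {N : Z → C} {c : Cofan N} (hc : IsColimit c)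

theorem inj_coproductProj_self (z : Z) : c.inj z ≫ coproductProj hc z = 𝟙 (N z) := by
  simp [coproductProj, Cofan.IsColimit.fac]

theorem inj_coproductProj_of_ne {w z : Z} (h : w ≠ z) : c.inj w ≫ coproductProj hc z = 0 := by
  simp [coproductProj, Cofan.IsColimit.fac, h]

theorem desc_comp_coproductProj {L : Z → C} {d : Cofan L} (hd : IsColimit d) (h : ∀ z, N z ⟶ L z)
    (z : Z) : Cofan.IsColimit.desc hc (fun z => h z ≫ d.inj z) ≫ coproductProj hd z =
      coproductProj hc z ≫ h z := by
  classical
  refine Cofan.IsColimit.hom_ext hc _ _ fun w => ?_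
  rw [← Category.assoc, Cofan.IsColimit.fac, Category.assoc, ← Category.assoc (c.inj w)]
  by_cases hwz : w = z
  · subst hwz
    rw [inj_coproductProj_self, inj_coproductProj_self, Category.comp_id, Category.id_comp]
  · rw [inj_coproductProj_of_ne hd hwz, inj_coproductProj_of_ne hc hwz, comp_zero, zero_comp]

theorem IsSummableFamily.exists_lift {M : C} {f : ∀ z, M ⟶ N z} (hf : IsSummableFamily f) :
    ∃ g : M ⟶ c.pt, ∀ z, g ≫ coproductProj hc z = f z := by
  obtain ⟨d, hd, g, hg⟩ := hf
  -- The witness of summability may use another coproduct `d`; this is the comparison map to `c`,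
  -- with identities inserted to fit `desc_comp_coproductProj`.
  refine ⟨g ≫ Cofan.IsColimit.desc hd (fun z => 𝟙 _ ≫ c.inj z), fun z => ?_⟩
  rw [Category.assoc, desc_comp_coproductProj, Category.comp_id, hg]

theorem bijOn_matrixEntry [IsAgreeable C] : Set.BijOn (matrixEntry hc) Set.univ {r | IsRowSummable r} := by
  refine ⟨fun r _ w => ⟨c, hc, c.inj w ≫ (show c.pt ⟶ c.pt from r.unop), fun z =>
    Category.assoc _ _ _⟩, fun r _ s _ hrs => ?_, fun r hr => ?_⟩
  · apply unop_injective
    refine Cofan.IsColimit.hom_ext hc _ _ fun w => ?_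
    refine IsAgreeable.injective hc _ _ fun z => ?_
    rw [Category.assoc, Category.assoc]
    exact congrFun (congrFun hrs w) z
  · choose g hg using fun w => (hr w).exists_lift hc
    refine ⟨op (Cofan.IsColimit.desc hc g), Set.mem_univ _, ?_⟩
    funext w z
    refine Eq.trans ?_ (hg w z)
    change c.inj w ≫ Cofan.IsColimit.desc hc g ≫ _ = _
    rw [← Category.assoc, Cofan.IsColimit.fac]

variable [RightTopologicalCategory C]

theorem RightTopologicalCategory.continuous_comp_right {L M K : C} (h : M ⟶ K) :
    Continuous fun f : L ⟶ M => f ≫ h :=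
  (RightTopologicalCategory.continuous_comp L M K).comp (continuous_id.prodMk continuous_const)

theorem RightTopologicalCategory.continuous_comp_left {L M K : C} (h : L ⟶ M) :
    Continuous fun f : M ⟶ K => h ≫ f :=
  (RightTopologicalCategory.continuous_comp L M K).comp (continuous_const.prodMk continuous_id)

theorem RightTopologicalCategory.exists_openAddSubgroup {M K : C} (U : Set (M ⟶ K))
    (hU : U ∈ 𝓝 0) : ∃ V : OpenAddSubgroup (M ⟶ K), (V : Set (M ⟶ K)) ⊆ U := by
  obtain ⟨V, hV, hVU, -⟩ := RightTopologicalCategory.exists_open_submodule M K U hU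
  exact ⟨⟨V, hV⟩, hVU⟩

instance RightTopologicalCategory.t2Space (M K : C) : T2Space (M ⟶ K) := by
  refine IsTopologicalAddGroup.t2Space_of_zero_sep fun f hf => ?_
  by_contra! h
  exact hf (RightTopologicalCategory.homSeparated M K f fun U =>
    h U (U.isOpen.mem_nhds U.zero_mem))

variable [IsTopologicallyAgreeable C]

/-- The family is summable: it arises from `g` followed by the map induced by `h` into the coproduct
of copies of `L`. -/
theorem tendsto_coproductProj_comp {M L : C} (g : M ⟶ c.pt) (h : ∀ z, N z ⟶ L) :
    Tendsto (fun z => g ≫ coproductProj hc z ≫ h z) cofinite (𝓝 0) := by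
  apply IsTopologicallyAgreeable.tendsto_zero
  have : HasCoproducts.{v} C := IsAgreeable.hasCoproducts
  have hd := coproductIsCoproduct fun _ : Z => L
  refine ⟨_, hd, g ≫ Cofan.IsColimit.desc hc (fun z => h z ≫ (Cofan.mk (∐ fun _ : Z => L) (Sigma.ι fun _ => L)).inj z), fun z => ?_⟩
  rw [Category.assoc, desc_comp_coproductProj]

/-- Completeness provides some sum; it has the same projections as `g`, so agreeability identifies
the two. -/
theorem hasSum_coproductProj_inj {M : C} (g : M ⟶ c.pt) :
    HasSum (fun z => g ≫ coproductProj hc z ≫ c.inj z) g := by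
  obtain ⟨s, hs⟩ := (RightTopologicalCategory.homComplete M c.pt).exists_hasSum
    RightTopologicalCategory.exists_openAddSubgroup (tendsto_coproductProj_comp hc g c.inj)
  convert hs
  refine IsAgreeable.injective hc _ _ fun y => ?_
  have h1 := hs.map (Preadditive.rightComp M (coproductProj hc y))
    (RightTopologicalCategory.continuous_comp_right (coproductProj hc y))
  refine HasSum.unique ?_ h1
  convert hasSum_single y ?_
  · change _ = (g ≫ coproductProj hc y ≫ c.inj y) ≫ coproductProj hc y
    simp [inj_coproductProj_self]
  · intro z hz
    change (g ≫ coproductProj hc z ≫ c.inj z) ≫ coproductProj hc y = 0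
    simp [inj_coproductProj_of_ne hc hz]

theorem hasSum_coproductProj_comp {M L : C} (g : M ⟶ c.pt) (h : c.pt ⟶ L) :
    HasSum (fun z => (g ≫ coproductProj hc z) ≫ (c.inj z ≫ h)) (g ≫ h) := by
  have := (hasSum_coproductProj_inj hc g).map (Preadditive.rightComp M h)
    (RightTopologicalCategory.continuous_comp_right h)
  convert! this using 2 with z
  change _ = (g ≫ coproductProj hc z ≫ c.inj z) ≫ h
  simp

theorem finite_setOf_isIso {A : C} (hA : IsLocalRing (EndOp A))
    (g : A ⟶ c.pt) : {z | IsIso (g ≫ coproductProj hc z)}.Finite := by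
  classical
  -- Returning to `A` by any isomorphism gives endomorphisms of `A` that converge to zero, hence are
  -- eventually nonisomorphisms. The default 0 is harmless: it occurs only where `N z` is not
  -- isomorphic to `A`.
  let h : ∀ z, N z ⟶ A := fun z => if hz : ∃ u : N z ⟶ A, IsIso u then hz.choose else 0
  have ht := tendsto_coproductProj_comp hc g h
  have hfin := ht ((isOpen_nonisoSubgroup hA hA).mem_nhds (nonisoSubgroup hA hA).zero_mem)
  refine Set.Finite.subset hfin fun z hz => ?_
  have hz' : IsIso (g ≫ coproductProj hc z) := hz
  simp only [Set.mem_compl_iff, Set.mem_preimage, SetLike.mem_coe, mem_nonisoSubgroup, not_not]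
  have hex : ∃ u : N z ⟶ A, IsIso u := ⟨inv (g ≫ coproductProj hc z), inferInstance⟩
  have : IsIso (h z) := by
    simp only [h, dif_pos hex]
    exact hex.choose_spec
  rw [← Category.assoc]
  infer_instance

end Coproducts

/-! ## Noncommutative local rings -/

namespace IsLocalRing

variable {R : Type*} [Ring R] [IsLocalRing R]

theorem isUnit_of_mul_eq_one_left {l a : R} (h : l * a = 1) : IsUnit a := by
  have hidem : (a * l) * (a * l) = a * l := by
    rw [mul_assoc, ← mul_assoc l a l, h, one_mul]
  have h1 : a * l + (1 - a * l) = 1 := by abel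
  rcases isUnit_or_isUnit_of_add_one h1 with h2 | h2
  · have h3 : a * l = 1 := h2.mul_left_cancel (by rw [hidem, mul_one])
    exact ⟨⟨a, l, h3, h⟩, rfl⟩
  · have h3 : a * l = 0 := h2.mul_left_cancel (by rw [sub_mul, hidem, one_mul, sub_self, mul_zero])
    have h4 : (1 : R) = 0 := by
      rw [← one_mul (1 : R), ← h, mul_assoc, ← mul_assoc a l a, h3, zero_mul, mul_zero]
    exact absurd h4 one_ne_zero

theorem isUnit_of_isUnit_mul {x a : R} (h : IsUnit (x * a)) : IsUnit a := by
  obtain ⟨u, hu⟩ := h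
  refine isUnit_of_mul_eq_one_left (l := ↑u⁻¹ * x) ?_
  rw [mul_assoc, ← hu, Units.inv_mul]

variable (R) in
/-- The left ideal of nonunits of a local ring. -/
def nonunitsIdeal : Ideal R where
  __ := nonunitsAddSubmonoid R
  smul_mem' _ _ hx h := hx (isUnit_of_isUnit_mul h)

theorem mem_nonunitsIdeal {a : R} : a ∈ nonunitsIdeal R ↔ ¬ IsUnit a := Iff.rfl

theorem le_nonunitsIdeal {I : Ideal R} (hI : I ≠ ⊤) : I ≤ nonunitsIdeal R := fun _ ha hu =>
  hI (I.eq_top_of_isUnit_mem ha hu)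

/-- The nonunits form a left ideal containing every proper left ideal, so it is the only maximal
one. -/
theorem mem_jacobson_iff {a : R} : a ∈ Ring.jacobson R ↔ ¬ IsUnit a := by
  have hne : nonunitsIdeal R ≠ ⊤ := fun h =>
    mem_nonunitsIdeal.1 ((Ideal.eq_top_iff_one _).1 h) isUnit_one
  have hmax : (nonunitsIdeal R).IsMaximal :=
    ⟨hne, fun J hJ => by
      by_contra h
      exact hJ.not_ge (le_nonunitsIdeal h)⟩
  rw [← mem_nonunitsIdeal]
  refine ⟨fun h => Ring.jacobson_le_of_isMaximal _ h, fun h => ?_⟩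
  rw [Ring.jacobson_eq_sInf_isMaximal]
  refine Submodule.mem_sInf.2 fun (J : Ideal R) hJ => ?_
  have hJ' : J.IsMaximal := hJ
  rwa [hJ'.eq_of_le hne (le_nonunitsIdeal hJ'.ne_top)]

end IsLocalRing

/-! ## Semisimplicity of discrete modules -/

/-- The annihilator of `m` is open, so it contains some `1 - ∑ i ∈ F, e i`, and `m` is a finite sum
of elements `m e_i`. If nonzero, `m e_i` generates a simple submodule, because any nonzero multiple
`m e_i s` is carried back to `m e_i` by `hsimple`. -/
theorem isSemisimpleModule_of_idempotents {S M ι : Type*} [Ring S] [TopologicalSpace S]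
    [AddCommGroup M] [Module Sᵐᵒᵖ M] (hM : ∀ m : M, IsOpen {s : S | op s • m = 0})
    (e : ι → S) (hsum : ∀ U ∈ 𝓝 (0 : S), ∃ F : Finset ι, 1 - ∑ i ∈ F, e i ∈ U)
    (hsimple : ∀ i s, e i * s ≠ 0 → ∃ t, e i * s * t = e i) : IsSemisimpleModule Sᵐᵒᵖ M := by
  have hsmul : ∀ (i : ι) (m : M), op (e i) • m ∈
      sSup {N : Submodule Sᵐᵒᵖ M | IsSimpleModule Sᵐᵒᵖ N} := by
    intro i m
    by_cases h0 : op (e i) • m = 0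
    · rw [h0]
      exact Submodule.zero_mem _
    refine le_sSup (a := Submodule.span Sᵐᵒᵖ {op (e i) • m}) ?_ (Submodule.mem_span_singleton_self _)
    refine isSimpleModule_iff_isAtom.2 ⟨fun h => h0 (Submodule.span_singleton_eq_bot.1 h),
      fun b hb => ?_⟩
    by_contra hbot
    obtain ⟨x, hxb, hx0⟩ := Submodule.exists_mem_ne_zero_of_ne_bot hbot
    obtain ⟨s, rfl⟩ := Submodule.mem_span_singleton.1 (hb.le hxb)
    obtain ⟨s, rfl⟩ := op_surjective s
    rw [smul_smul, ← op_mul] at hx0 hxb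
    obtain ⟨t, ht⟩ := hsimple i s fun h => hx0 (by rw [h, MulOpposite.op_zero, zero_smul])
    have := b.smul_mem (op t) hxb
    rw [smul_smul, ← op_mul, ht] at this
    exact hb.not_ge ((Submodule.span_singleton_le_iff_mem _ _).2 this)
  refine .of_sSup_simples_eq_top (eq_top_iff.2 fun m _ => ?_)
  obtain ⟨F, hF⟩ := hsum {s : S | op s • m = 0} ((hM m).mem_nhds (by simp))
  have hm : m = ∑ i ∈ F, op (e i) • m := by
    have hF' : op (1 - ∑ i ∈ F, e i) • m = 0 := hF
    rwa [MulOpposite.op_sub, op_one, sub_smul, one_smul, Finset.op_sum, Finset.sum_smul, sub_eq_zero] at hF'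
  rw [hm]
  exact Submodule.sum_mem _ fun i _ => hsmul i m

/-! ## Completeness of groups of matrices given by their rows -/

section Rows

variable {ι : Type*} {B : ι → Type*}
  [∀ i, AddCommGroup (B i)]

theorem isLinearlySeparated_of_rows {A : Type v} [AddCommGroup A] [TopologicalSpace A]
    (ρ : ∀ i, A →+ B i) (hinj : ∀ a, (∀ i, ρ i a = 0) → a = 0)
    (hopen : ∀ i, IsOpen ((ρ i).ker : Set A)) : IsLinearlySeparated A := fun a ha =>
  hinj a fun i => ha ⟨(ρ i).ker, hopen i⟩

theorem isLinearlyComplete_of_rows {A : Type v} [AddCommGroup A] [TopologicalSpace A]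
    [IsTopologicalAddGroup A]
    (ρ : ∀ i, A →+ B i) (hsurj : ∀ b : ∀ i, B i, ∃ a, ∀ i, ρ i a = b i)
    (hopen : ∀ i, IsOpen ((ρ i).ker : Set A))
    (hbase : ∀ U ∈ 𝓝 (0 : A), ∃ F : Finset ι, ∀ a, (∀ i ∈ F, ρ i a = 0) → a ∈ U) :
    IsLinearlyComplete A := by
  intro c hc
  let K : ι → OpenAddSubgroup A := fun i => ⟨(ρ i).ker, hopen i⟩
  obtain ⟨a, ha⟩ := hsurj fun i => ρ i (c (K i))
  refine ⟨a, fun U => ?_⟩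
  obtain ⟨F, hF⟩ := hbase U (U.isOpen.mem_nhds U.zero_mem)
  -- The intersection of `U` with the finitely many kernels that control `U` is where compatibility
  -- links the rows of `a` to the coset of `c U`.
  have h1 : a - c (F.inf K ⊓ U) ∈ U := hF _ fun i hi => by
    have h2 : c (F.inf K ⊓ U) - c (K i) ∈ K i := hc _ _ (inf_le_left.trans (Finset.inf_le hi))
    have h3 : ρ i (c (F.inf K ⊓ U) - c (K i)) = 0 := h2
    rw [map_sub, sub_eq_zero] at h3
    rw [map_sub, ha, h3, sub_self]
  have := U.add_mem h1 (hc (F.inf K ⊓ U) U inf_le_right)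
  rwa [sub_add_sub_cancel] at this

end Rows

/-! ## Topology of products of rings of row-finite matrices -/

namespace RowFiniteMatrix

/-- The rows of a row-finite matrix, as a homomorphism. -/
def rowHom (Y D : Type v) [Ring D] : RowFiniteMatrix Y D →+ (Y → Y →₀ D) where
  toFun := row
  map_zero' := zero_row
  map_add' := add_row

instance {Y D : Type v} [Ring D] : IsTopologicalAddGroup (RowFiniteMatrix Y D) := by
  let : TopologicalSpace (Y →₀ D) := ⊥
  have : DiscreteTopology (Y →₀ D) := ⟨rfl⟩
  exact topologicalAddGroup_induced (rowHom Y D)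

theorem mem_nhds_zero_iff {Y D : Type v} [Ring D] {U : Set (RowFiniteMatrix Y D)} :
    U ∈ 𝓝 0 ↔ ∃ F : Finset Y, ∀ A, (∀ w ∈ F, A.row w = 0) → A ∈ U := by
  let : TopologicalSpace (Y →₀ D) := ⊥
  have : DiscreteTopology (Y →₀ D) := ⟨rfl⟩
  rw [nhds_induced, mem_comap, zero_row, nhds_pi]
  constructor
  · rintro ⟨V, hV, hVU⟩
    obtain ⟨I, hI, t, ht, htV⟩ := mem_pi.1 hV
    refine ⟨hI.toFinset, fun A hA => hVU (htV fun w hw => ?_)⟩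
    rw [hA w (hI.mem_toFinset.2 hw)]
    exact mem_of_mem_nhds (ht w)
  · rintro ⟨F, hF⟩
    refine ⟨(F : Set Y).pi fun _ => {0}, pi_mem_pi F.finite_toSet fun w _ => ?_,
      fun A hA => hF A fun w hw => hA w hw⟩
    simp [nhds_discrete]

variable {X : Type v} {Y D : X → Type v} [∀ x, Ring (D x)]

theorem pi_mem_nhds_zero_iff {U : Set (∀ x, RowFiniteMatrix (Y x) (D x))} :
    U ∈ 𝓝 0 ↔ ∃ F : Finset (Σ x, Y x), ∀ A, (∀ p ∈ F, (A p.1).row p.2 = 0) → A ∈ U := by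
  classical
  rw [nhds_pi, mem_pi]
  constructor
  · rintro ⟨I, hI, t, ht, htU⟩
    choose F hF using fun x => mem_nhds_zero_iff.1 (ht x)
    exact ⟨hI.toFinset.sigma F, fun A hA => htU fun x hx => hF x _ fun w hw =>
      hA ⟨x, w⟩ (Finset.mem_sigma.2 ⟨hI.mem_toFinset.2 hx, hw⟩)⟩
  · rintro ⟨F, hF⟩
    refine ⟨F.image Sigma.fst, Finset.finite_toSet _,
      fun x => {A | ∀ w, (⟨x, w⟩ : Σ x, Y x) ∈ F → A.row w = 0}, fun x => ?_, fun A hA => ?_⟩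
    · exact mem_nhds_zero_iff.2 ⟨F.preimage (Sigma.mk x) sigma_mk_injective.injOn,
        fun A hA w hw => hA w (Finset.mem_preimage.2 hw)⟩
    · exact hF A fun p hp => hA p.1 (Finset.mem_coe.2 (Finset.mem_image_of_mem _ hp)) p.2 hp

instance : T2Space (∀ x, RowFiniteMatrix (Y x) (D x)) := by
  refine IsTopologicalAddGroup.t2Space_of_zero_sep fun A hA => ?_
  by_contra! h
  refine hA (funext fun x => ext_row fun w => ?_)
  exact h {A | (A x).row w = 0} (pi_mem_nhds_zero_iff.2
    ⟨{⟨x, w⟩}, fun A hA => hA ⟨x, w⟩ (Finset.mem_singleton_self _)⟩)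

/-- A row of a family of row-finite matrices. -/
def piRow (p : Σ x, Y x) : (∀ x, RowFiniteMatrix (Y x) (D x)) →+ (Y p.1 →₀ D p.1) where
  toFun A := (A p.1).row p.2
  map_zero' := rfl
  map_add' _ _ := rfl

end RowFiniteMatrix

/-! ## Quotients of topological rings isomorphic to products of rings of row-finite matrices -/

section TopologicalQuotient

variable {R : Type v} [Ring R] [TopologicalSpace R] [IsTopologicalRing R]

theorem Ideal.Quotient.isOpenQuotientMap_mk (I : Ideal R) [I.IsTwoSided] :
    IsOpenQuotientMap (Ideal.Quotient.mk I) :=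
  QuotientAddGroup.isOpenQuotientMap_mk (N := I.toAddSubgroup)

instance Ideal.Quotient.instIsTopologicalAddGroup (I : Ideal R) :
    IsTopologicalAddGroup (R ⧸ I) :=
  QuotientAddGroup.instIsTopologicalAddGroup I.toAddSubgroup

theorem Ideal.Quotient.isTopologicalRing (I : Ideal R) [I.IsTwoSided] :
    IsTopologicalRing (R ⧸ I) where
  __ := Ideal.Quotient.instIsTopologicalAddGroup I
  continuous_mul :=
    ((isOpenQuotientMap_mk I).prodMap (isOpenQuotientMap_mk I)).isQuotientMap.continuous_iff.2 <|
      (isOpenQuotientMap_mk I).continuous.comp continuous_mul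

theorem Ideal.Quotient.isLinearTopology_op (I : Ideal R) [I.IsTwoSided]
    (hR : ∀ U ∈ 𝓝 (0 : R), ∃ V : Submodule Rᵐᵒᵖ R, (V : Set R) ∈ 𝓝 0 ∧ (V : Set R) ⊆ U) :
    IsLinearTopology (R ⧸ I)ᵐᵒᵖ (R ⧸ I) where
  hasBasis_submodule' := by
    refine ⟨fun U => ⟨fun hU => ?_, fun ⟨V, hV, hVU⟩ => mem_of_superset hV hVU⟩⟩
    obtain ⟨V, hV, hVU⟩ := hR (Ideal.Quotient.mk I ⁻¹' U)
      ((isOpenQuotientMap_mk I).continuous.continuousAt (by rwa [map_zero]))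
    let W : Submodule (R ⧸ I)ᵐᵒᵖ (R ⧸ I) :=
      { V.toAddSubmonoid.map (Ideal.Quotient.mk I) with
        smul_mem' := by
          rintro s _ ⟨a, ha, rfl⟩
          obtain ⟨r, hr⟩ := Ideal.Quotient.mk_surjective s.unop
          refine ⟨a * r, V.smul_mem (op r) ha, ?_⟩
          change Ideal.Quotient.mk I (a * r) = Ideal.Quotient.mk I a * s.unop
          rw [map_mul, hr] }
    have hW : (W : Set (R ⧸ I)) = Ideal.Quotient.mk I '' V := rfl
    refine ⟨W, ?_, ?_⟩
    · rw [hW, ← map_zero (Ideal.Quotient.mk I)]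
      exact (isOpenQuotientMap_mk I).isOpenMap.image_mem_nhds hV
    · rw [hW]
      exact Set.image_subset_iff.2 hVU

variable {X : Type v} {Y D : X → Type v} [∀ x, Ring (D x)]
  (φ : R →+* ∀ x, RowFiniteMatrix (Y x) (D x)) (s : (∀ x, RowFiniteMatrix (Y x) (D x)) → R)

/-- Since φ is additive, openness need only be checked at zero, where the image of `U` contains the
preimage of `U` under `s`. No additivity of `s` is required. -/
theorem isOpenMap_of_section (hs : ∀ A, φ (s A) = A) (hs0 : Tendsto s (𝓝 0) (𝓝 0)) :
    IsOpenMap φ := by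
  refine IsTopologicalAddGroup.isOpenMap_iff_nhds_zero.2 fun U hU => ?_
  filter_upwards [hs0 (mem_map.1 hU)] with A hA
  have : φ (s A) ∈ U := hA
  rwa [hs] at this

theorem isHomeomorph_quotientKerEquiv (hφ : Continuous φ) (ho : IsOpenMap φ)
    (hsurj : Function.Surjective φ) :
    IsHomeomorph (RingHom.quotientKerEquivOfSurjective hsurj) := by
  have hq := Ideal.Quotient.isOpenQuotientMap_mk (RingHom.ker φ)
  have hcomp : RingHom.quotientKerEquivOfSurjective hsurj ∘ Ideal.Quotient.mk (RingHom.ker φ) = φ :=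
    rfl
  refine ⟨hq.isQuotientMap.continuous_iff.2 (hcomp ▸ hφ), fun U hU => ?_, RingEquiv.bijective _⟩
  have := ho _ (hU.preimage hq.continuous)
  rwa [← hcomp, Set.image_comp, Set.image_preimage_eq _ hq.surjective] at this

section Transfer

variable {S : Type v} [Ring S] [TopologicalSpace S]
  (e : S ≃+* ∀ x, RowFiniteMatrix (Y x) (D x))

/-- The rows of the matrices corresponding to the elements of `S`. -/
def rowOf (p : Σ x, Y x) : S →+ (Y p.1 →₀ D p.1) :=
  (RowFiniteMatrix.piRow p).comp (e : S →+ ∀ x, RowFiniteMatrix (Y x) (D x))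

theorem mem_nhds_zero_iff_rowOf (he : IsHomeomorph e) {U : Set S} :
    U ∈ 𝓝 0 ↔ ∃ F : Finset (Σ x, Y x), ∀ a, (∀ p ∈ F, rowOf e p a = 0) → a ∈ U := by
  rw [he.isInducing.nhds_eq_comap, map_zero, mem_comap]
  constructor
  · rintro ⟨V, hV, hVU⟩
    obtain ⟨F, hF⟩ := RowFiniteMatrix.pi_mem_nhds_zero_iff.1 hV
    exact ⟨F, fun a ha => hVU (hF _ ha)⟩
  · rintro ⟨F, hF⟩
    refine ⟨e.symm ⁻¹' U, RowFiniteMatrix.pi_mem_nhds_zero_iff.2 ⟨F, fun A hA => hF _ fun p hp => ?_⟩,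
      fun a ha => ?_⟩
    · rw [← hA p hp]
      change (e (e.symm A) p.1).row p.2 = _
      rw [e.apply_symm_apply]
    · have : e.symm (e a) ∈ U := ha
      rwa [e.symm_apply_apply] at this

theorem isOpen_ker_rowOf [IsTopologicalAddGroup S] (he : IsHomeomorph e) (p : Σ x, Y x) :
    IsOpen ((rowOf e p).ker : Set S) :=
  AddSubgroup.isOpen_of_mem_nhds _ (g := 0) ((mem_nhds_zero_iff_rowOf e he).2
    ⟨{p}, fun _ ha => ha p (Finset.mem_singleton_self p)⟩)

theorem isLinearlySeparated_of_isHomeomorph [IsTopologicalAddGroup S] (he : IsHomeomorph e) : IsLinearlySeparated S :=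
  isLinearlySeparated_of_rows (rowOf e) (fun a ha => e.injective (by
    rw [map_zero]
    exact funext fun x => RowFiniteMatrix.ext_row fun w => ha ⟨x, w⟩)) (isOpen_ker_rowOf e he)

theorem isLinearlyComplete_of_isHomeomorph [IsTopologicalAddGroup S] (he : IsHomeomorph e) : IsLinearlyComplete S :=
  isLinearlyComplete_of_rows (rowOf e)
    (fun b => ⟨e.symm fun x => ⟨fun w => b ⟨x, w⟩⟩, fun p => by
      change (e (e.symm _) p.1).row p.2 = _
      rw [e.apply_symm_apply]⟩)
    (isOpen_ker_rowOf e he) fun _ hU => (mem_nhds_zero_iff_rowOf e he).1 hU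

end Transfer

/-- Completeness comes from the homeomorphism with the product of matrix rings; families are lifted
by applying `s` to their images there. -/
theorem isStronglyClosed_ker (hφ : Continuous φ) (hs : ∀ A, φ (s A) = A)
    (hs0 : Tendsto s (𝓝 0) (𝓝 0)) : IsStronglyClosed (RingHom.ker φ).toAddSubgroup where
  isClosed := isClosed_singleton.preimage hφ
  complete_quotient :=
    have hsurj : Function.Surjective φ := fun A => ⟨s A, hs A⟩
    isLinearlyComplete_of_isHomeomorph _
      (isHomeomorph_quotientKerEquiv φ hφ (isOpenMap_of_section φ s hs hs0) hsurj)
  lift_family J q hq := by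
    have hsurj : Function.Surjective φ := fun A => ⟨s A, hs A⟩
    let e := RingHom.quotientKerEquivOfSurjective hsurj
    have he : IsHomeomorph e :=
      isHomeomorph_quotientKerEquiv φ hφ (isOpenMap_of_section φ s hs hs0) hsurj
    have hq' : Tendsto (fun j => e (q j)) cofinite (𝓝 0) := by
      have := (he.continuous.tendsto 0).comp hq
      rwa [map_zero] at this
    refine ⟨fun j => s (e (q j)), hs0.comp hq', fun j => e.injective ?_⟩
    exact hs (e (q j))

end TopologicalQuotient

/-! ## Residue rings -/

section ResidueRings

variable {C : Type u} [Category.{v} C] [Preadditive C]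

theorem ResidueRing.mk_of_eq_zero_iff {A : C} (hA : IsLocalRing (EndOp A)) (f : A ⟶ A) :
    Ideal.Quotient.mk (Ring.jacobson (EndOp A)) (EndOp.of f) = 0 ↔ ¬ IsIso f := by
  rw [Ideal.Quotient.eq_zero_iff_mem, IsLocalRing.mem_jacobson_iff, EndOp.isUnit_of_iff]

theorem ResidueRing.nontrivial_and_isUnit {A : C} (hA : IsLocalRing (EndOp A)) :
    Nontrivial (ResidueRing A) ∧ ∀ a : ResidueRing A, a ≠ 0 → IsUnit a := by
  constructor
  · refine ⟨⟨1, 0, fun h => ?_⟩⟩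
    exact (ResidueRing.mk_of_eq_zero_iff hA (𝟙 A)).1 h inferInstance
  · intro a ha
    obtain ⟨a, rfl⟩ := Ideal.Quotient.mk_surjective a
    have : IsUnit a := by
      by_contra h
      exact ha (Ideal.Quotient.eq_zero_iff_mem.2 (IsLocalRing.mem_jacobson_iff.2 h))
    exact this.map _

/-- A representative of a residue class; the class zero is represented by zero. -/
def ResidueRing.lift {A : C} (d : ResidueRing A) : A ⟶ A :=
  open Classical in
  if d = 0 then 0 else (Ideal.Quotient.mk_surjective d).choose.hom

theorem ResidueRing.lift_zero {A : C} : ResidueRing.lift (0 : ResidueRing A) = 0 := by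
  simp [ResidueRing.lift]

theorem ResidueRing.mk_lift {A : C} (d : ResidueRing A) :
    Ideal.Quotient.mk (Ring.jacobson (EndOp A)) (EndOp.of d.lift) = d := by
  by_cases h : d = 0
  · rw [h, ResidueRing.lift_zero]
    exact map_zero _
  · rw [ResidueRing.lift, if_neg h]
    exact (Ideal.Quotient.mk_surjective d).choose_spec

variable {Z : Type v} {N : Z → C}

/-- A chosen isomorphism from an object of an isomorphism class to the representative of the
class. -/
def isoOut {x : IsoClasses N} (w : IsoClassFiber N x) : N w ≅ N x.out :=
  Classical.choice (Quotient.exact (w.2.trans (Quotient.out_eq x).symm))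

/-- The residue class of a morphism between two objects of an isomorphism class. -/
def residue {x : IsoClasses N} (w z : IsoClassFiber N x) : (N w ⟶ N z) →+ ResidueRing (N x.out) where
  toFun f := Ideal.Quotient.mk _ (EndOp.of ((isoOut w).inv ≫ f ≫ (isoOut z).hom))
  map_zero' := by
    rw [zero_comp, comp_zero]
    exact map_zero _
  map_add' f g := by
    rw [Preadditive.add_comp, Preadditive.comp_add]
    exact map_add _ _ _

theorem residue_eq_zero_iff (hlocal : ∀ z, IsLocalRing (EndOp (N z))) {x : IsoClasses N} {w z : IsoClassFiber N x} {f : N w ⟶ N z} :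
    residue w z f = 0 ↔ ¬ IsIso f := by
  refine (ResidueRing.mk_of_eq_zero_iff (hlocal _) _).trans (not_congr ?_)
  rw [isIso_comp_left_iff, isIso_comp_right_iff]

theorem residue_comp {x : IsoClasses N} (w y z : IsoClassFiber N x) (f : N w ⟶ N y)
    (g : N y ⟶ N z) : residue w z (f ≫ g) = residue w y f * residue y z g := by
  refine Eq.trans ?_ (map_mul (Ideal.Quotient.mk _) _ _)
  refine congrArg (fun h => Ideal.Quotient.mk _ (EndOp.of h)) ?_
  change _ = ((isoOut w).inv ≫ f ≫ (isoOut y).hom) ≫ ((isoOut y).inv ≫ g ≫ (isoOut z).hom)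
  simp

theorem residue_id {x : IsoClasses N} (w : IsoClassFiber N x) : residue w w (𝟙 _) = 1 := by
  refine Eq.trans ?_ (map_one (Ideal.Quotient.mk _))
  refine congrArg (fun h => Ideal.Quotient.mk _ (EndOp.of h)) ?_
  simp

/-- A representative of a residue class as a morphism between two objects of an isomorphism
class. -/
def residueLift {x : IsoClasses N} (w z : IsoClassFiber N x) (d : ResidueRing (N x.out)) :
    N w ⟶ N z :=
  (isoOut w).hom ≫ d.lift ≫ (isoOut z).inv

theorem residue_residueLift {x : IsoClasses N} (w z : IsoClassFiber N x)
    (d : ResidueRing (N x.out)) : residue w z (residueLift w z d) = d := by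
  refine Eq.trans ?_ (ResidueRing.mk_lift d)
  refine congrArg (fun h => Ideal.Quotient.mk _ (EndOp.of h)) ?_
  simp [residueLift]

end ResidueRings

/-! ## The homomorphism to the product of rings of row-finite matrices -/

section Matrices

variable {C : Type u} [Category.{v} C] [Preadditive C]

variable {Z : Type v} {N : Z → C} {c : Cofan N} (hc : IsColimit c)

theorem matrixEntry_add (r s : EndOp c.pt) (w z : Z) :
    matrixEntry hc (r + s) w z = matrixEntry hc r w z + matrixEntry hc s w z := by
  change c.inj w ≫ (r.hom + s.hom) ≫ _ = c.inj w ≫ r.hom ≫ _ + c.inj w ≫ s.hom ≫ _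
  rw [Preadditive.add_comp, Preadditive.comp_add]

theorem matrixEntry_one_self (z : Z) : matrixEntry hc 1 z z = 𝟙 _ := by
  change c.inj z ≫ 𝟙 _ ≫ _ = _
  rw [Category.id_comp, inj_coproductProj_self]

theorem matrixEntry_one_of_ne {w z : Z} (h : w ≠ z) : matrixEntry hc 1 w z = 0 := by
  change c.inj w ≫ 𝟙 _ ≫ _ = _
  rw [Category.id_comp, inj_coproductProj_of_ne hc h]

/-- A set-theoretic section of the homomorphism to the product of the rings of row-finite
matrices. -/
def residueMatrixLift
    (A : ∀ x : IsoClasses N, RowFiniteMatrix (IsoClassFiber N x) (ResidueRing (N x.out))) :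
    EndOp c.pt :=
  EndOp.of <| Cofan.IsColimit.desc hc fun w =>
    ((A (Quotient.mk (isoSetoid N) w)).row ⟨w, rfl⟩).sum fun z d =>
      residueLift ⟨w, rfl⟩ z d ≫ c.inj z

theorem inj_residueMatrixLift
    (A : ∀ x : IsoClasses N, RowFiniteMatrix (IsoClassFiber N x) (ResidueRing (N x.out))) (w : Z) :
    c.inj w ≫ (residueMatrixLift hc A).hom =
      ((A (Quotient.mk (isoSetoid N) w)).row ⟨w, rfl⟩).sum fun z d =>
        residueLift ⟨w, rfl⟩ z d ≫ c.inj z :=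
  Cofan.IsColimit.fac hc _ w

/-- The idempotent endomorphism of a coproduct projecting it to a summand. -/
def coproductIdempotent (w : Z) : EndOp c.pt := EndOp.of (coproductProj hc w ≫ c.inj w)

/-- The factor `t` returns from the summand `z` to the summand `w` through the inverse of the entry.
-/
theorem exists_coproductIdempotent_mul_eq {r : EndOp c.pt} {w : Z} {z : Z}
    (h : IsIso (matrixEntry hc r w z)) :
    ∃ t, coproductIdempotent hc w * r * t = coproductIdempotent hc w := by
  refine ⟨EndOp.of (coproductProj hc z ≫ inv (matrixEntry hc r w z) ≫ c.inj w), ?_⟩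
  refine congrArg EndOp.of ?_
  change ((coproductProj hc w ≫ c.inj w) ≫ r.hom) ≫
    (coproductProj hc z ≫ inv (matrixEntry hc r w z) ≫ c.inj w) = _
  have h2 : c.inj w ≫ r.hom ≫ coproductProj hc z = matrixEntry hc r w z := rfl
  simp only [Category.assoc]
  rw [reassoc_of% h2, IsIso.hom_inv_id_assoc]

theorem exists_isIso_of_coproductIdempotent_mul
    (hlocal : ∀ z, IsLocalRing (EndOp (N z))) {r : EndOp c.pt} {w : Z}
    (h : coproductIdempotent hc w * r ∉ nonisoMatrices hc) :
    ∃ z, IsIso (matrixEntry hc r w z) := by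
  by_contra! h'
  refine h fun y z hyz => ?_
  have h1 : matrixEntry hc (coproductIdempotent hc w * r) y z =
      (c.inj y ≫ coproductProj hc w) ≫ matrixEntry hc r w z := by
    change c.inj y ≫ ((coproductProj hc w ≫ c.inj w) ≫ r.hom) ≫ coproductProj hc z =
      (c.inj y ≫ coproductProj hc w) ≫ c.inj w ≫ r.hom ≫ coproductProj hc z
    simp only [Category.assoc]
  rw [h1] at hyz
  exact h' z (isIso_right_of_isIso_comp (hlocal y) (hlocal w) _ _ hyz)

variable [RightTopologicalCategory C]

instance EndOp.isTopologicalRing (M : C) : IsTopologicalRing (EndOp M) :=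
  have : IsTopologicalRing (End M) :=
    { (RightTopologicalCategory.homTopologicalAddGroup M M : IsTopologicalAddGroup (M ⟶ M)) with
      continuous_mul :=
        (RightTopologicalCategory.continuous_comp M M M).comp continuous_swap }
  inferInstance

theorem exists_open_right_ideal (M : C) (U : Set (EndOp M)) (hU : U ∈ 𝓝 0) :
    ∃ V : Submodule (EndOp M)ᵐᵒᵖ (EndOp M), (V : Set (EndOp M)) ∈ 𝓝 0 ∧
      (V : Set (EndOp M)) ⊆ U := by
  obtain ⟨V, hV, hVU, hVs⟩ := RightTopologicalCategory.exists_open_submodule M M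
    (EndOp.of ⁻¹' U) (continuous_op.continuousAt hU)
  refine ⟨{ carrier := EndOp.hom ⁻¹' V
            zero_mem' := V.zero_mem
            add_mem' := V.add_mem
            smul_mem' := fun s r hr => hVs _ hr s.unop.unop }, ?_, fun r hr => hVU hr⟩
  exact (hV.preimage continuous_unop).mem_nhds V.zero_mem

variable [IsTopologicallyAgreeable C]

/-- Matrix multiplication with infinite sums: the decomposition of the middle coproduct into its
summands is inserted between `r` and `s`. -/
theorem hasSum_matrixEntry_mul (r s : EndOp c.pt) (w z : Z) :
    HasSum (fun y => matrixEntry hc r w y ≫ matrixEntry hc s y z) (matrixEntry hc (r * s) w z) := by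
  have := hasSum_coproductProj_comp hc (c.inj w ≫ r.hom) (s.hom ≫ coproductProj hc z)
  convert! this using 1
  · funext y
    exact congrArg (· ≫ matrixEntry hc s y z) (Category.assoc _ _ _).symm
  · change c.inj w ≫ (r.hom ≫ s.hom) ≫ _ = _
    simp only [Category.assoc]

theorem finite_setOf_isIso_matrixEntry (hlocal : ∀ z, IsLocalRing (EndOp (N z)))
    (r : EndOp c.pt) (w : Z) : {z | IsIso (matrixEntry hc r w z)}.Finite := by
  convert finite_setOf_isIso hc (hlocal w) (c.inj w ≫ r.hom) using 4 with z
  rw [Category.assoc]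
  rfl

variable (hlocal : ∀ z, IsLocalRing (EndOp (N z)))

/-- The row-finite matrices of residue classes of the entries of the matrix of an endomorphism of
a coproduct. -/
def residueMatrix (r : EndOp c.pt) (x : IsoClasses N) :
    RowFiniteMatrix (IsoClassFiber N x) (ResidueRing (N x.out)) where
  row w := Finsupp.ofSupportFinite (fun z => residue w z (matrixEntry hc r w z)) <| by
    refine Set.Finite.subset ((finite_setOf_isIso_matrixEntry hc hlocal r w).preimage
      Subtype.val_injective.injOn) fun z hz => ?_
    by_contra h
    exact hz ((residue_eq_zero_iff hlocal).2 h)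

theorem residueMatrix_row_apply (r : EndOp c.pt) {x : IsoClasses N} (w z : IsoClassFiber N x) :
    (residueMatrix hc hlocal r x).row w z = residue w z (matrixEntry hc r w z) := rfl

theorem residueMatrix_add (r s : EndOp c.pt) (x : IsoClasses N) :
    residueMatrix hc hlocal (r + s) x = residueMatrix hc hlocal r x + residueMatrix hc hlocal s x := by
  refine RowFiniteMatrix.ext_row fun w => Finsupp.ext fun z => ?_
  rw [RowFiniteMatrix.add_row, Pi.add_apply, Finsupp.add_apply]
  simp only [residueMatrix_row_apply, matrixEntry_add, map_add]

theorem residueMatrix_one (x : IsoClasses N) : residueMatrix hc hlocal 1 x = 1 := by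
  refine RowFiniteMatrix.ext_row fun w => Finsupp.ext fun z => ?_
  classical
  rw [RowFiniteMatrix.one_row, residueMatrix_row_apply]
  by_cases h : w = z
  · subst h
    rw [matrixEntry_one_self, residue_id, Finsupp.single_eq_same]
  · rw [matrixEntry_one_of_ne hc fun h' => h (Subtype.ext h'), map_zero,
      Finsupp.single_eq_of_ne (Ne.symm h)]

theorem residueMatrix_mul (r s : EndOp c.pt) (x : IsoClasses N) :
    residueMatrix hc hlocal (r * s) x = residueMatrix hc hlocal r x * residueMatrix hc hlocal s x := by
  refine RowFiniteMatrix.ext_row fun w => Finsupp.ext fun z => ?_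
  rw [RowFiniteMatrix.mul_entry, Finsupp.sum]
  simp only [residueMatrix_row_apply, ← residue_comp]
  rw [← map_sum, ← sub_eq_zero, ← map_sub, residue_eq_zero_iff hlocal]
  -- Modulo nonisomorphisms only the indices `y` with `r_{w,y}` invertible contribute: if a
  -- composite is invertible, so is its left factor, and then `y` lies in the class of `w`.
  have := AddSubgroup.sub_sum_mem_of_hasSum (hasSum_matrixEntry_mul hc r s w z)
    (nonisoSubgroup (hlocal w) (hlocal z)) (isOpen_nonisoSubgroup (hlocal w) (hlocal z))
    (((residueMatrix hc hlocal r x).row w).support.map (Function.Embedding.subtype _))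
    (fun y hy hiso => ?_)
  · rwa [Finset.sum_map] at this
  · have hy' := isIso_left_of_isIso_comp (hlocal w) (hlocal y) _ _ hiso
    refine hy (Finset.mem_map.2 ⟨⟨y, ?_⟩, ?_, rfl⟩)
    · rw [← w.2]
      exact Quotient.sound ⟨(asIso (matrixEntry hc r w y)).symm⟩
    · rw [Finsupp.mem_support_iff, residueMatrix_row_apply, Ne, residue_eq_zero_iff hlocal, not_not]
      exact hy'

/-- The homomorphism from the ring of endomorphisms of a coproduct of objects with local
endomorphism rings to the product of the rings of row-finite matrices over the residue rings. -/
def residueMatrixHom : EndOp c.pt →+*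
    ∀ x : IsoClasses N, RowFiniteMatrix (IsoClassFiber N x) (ResidueRing (N x.out)) :=
  RingHom.mk' ⟨⟨residueMatrix hc hlocal, funext (residueMatrix_one hc hlocal)⟩,
    fun r s => funext (residueMatrix_mul hc hlocal r s)⟩
    fun r s => funext (residueMatrix_add hc hlocal r s)

theorem residueMatrix_row_eq_zero_iff (r : EndOp c.pt) (w : Z) :
    (residueMatrix hc hlocal r (Quotient.mk (isoSetoid N) w)).row ⟨w, rfl⟩ = 0 ↔
      ∀ z, ¬ IsIso (matrixEntry hc r w z) := by
  constructor
  · intro h z hz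
    have h' := DFunLike.congr_fun h ⟨z, Quotient.sound ⟨(asIso (matrixEntry hc r w z)).symm⟩⟩
    rw [residueMatrix_row_apply, Finsupp.zero_apply, residue_eq_zero_iff hlocal] at h'
    exact h' hz
  · exact fun h => Finsupp.ext fun z => (residue_eq_zero_iff hlocal).2 (h z)

theorem mem_ker_residueMatrixHom (r : EndOp c.pt) :
    r ∈ RingHom.ker (residueMatrixHom hc hlocal) ↔ r ∈ nonisoMatrices hc := by
  rw [RingHom.mem_ker]
  constructor
  · intro h w
    rw [← residueMatrix_row_eq_zero_iff hc hlocal]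
    have h' : residueMatrix hc hlocal r (Quotient.mk (isoSetoid N) w) = 0 := congrFun h _
    rw [h']
    rfl
  · refine fun h => funext fun x => RowFiniteMatrix.ext_row fun w => ?_
    obtain ⟨w, rfl⟩ := w
    exact (residueMatrix_row_eq_zero_iff hc hlocal r w).2 (h w)

/-- A whole row is controlled by its single entry at `w`: in an open submodule `V` of `Hom(N w, M)`
all of whose members have noninvertible component at `w`, an invertible component at `z` could be
moved to `w` by an endomorphism of the coproduct `M`, producing the identity there. -/
theorem continuous_residueMatrixHom : Continuous (residueMatrixHom hc hlocal) := by
  refine continuous_of_continuousAt_zero _ fun U hU => ?_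
  rw [map_zero] at hU
  obtain ⟨F, hF⟩ := RowFiniteMatrix.pi_mem_nhds_zero_iff.1 hU
  refine mem_map.2 (mem_of_superset ((biInter_finset_mem F).2 fun p _ => ?_)
    fun r hr => hF _ fun p hp => Set.mem_iInter₂.1 hr p hp)
  obtain ⟨x, w, rfl⟩ := p
  obtain ⟨V, hVo, hVU, hV⟩ := RightTopologicalCategory.exists_open_submodule (N w) c.pt
    {f | ¬ IsIso (f ≫ coproductProj hc w)}
    (((isOpen_nonisoSubgroup (hlocal w) (hlocal w)).preimage
      (RightTopologicalCategory.continuous_comp_right (coproductProj hc w))).mem_nhds (by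
        rw [Set.mem_preimage, zero_comp]
        exact AddSubgroup.zero_mem _))
  have hmem : {r : EndOp c.pt | c.inj w ≫ r.hom ∈ V} ∈ 𝓝 0 :=
    (hVo.preimage ((RightTopologicalCategory.continuous_comp_left (c.inj w)).comp
      continuous_unop)).mem_nhds (by
        change c.inj w ≫ 0 ∈ V
        rw [comp_zero]
        exact V.zero_mem)
  filter_upwards [hmem] with r hr
  refine (residueMatrix_row_eq_zero_iff hc hlocal r w).2 fun z hz => ?_
  have h1 := hVU (hV _ hr (coproductProj hc z ≫ inv (matrixEntry hc r w z) ≫ c.inj w))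
  apply h1
  have h2 : (c.inj w ≫ r.hom) ≫ coproductProj hc z = matrixEntry hc r w z := Category.assoc _ _ _
  have h3 : ((c.inj w ≫ r.hom) ≫ coproductProj hc z ≫ inv (matrixEntry hc r w z) ≫ c.inj w) ≫
      coproductProj hc w = 𝟙 _ := by
    rw [← Category.assoc (c.inj w ≫ r.hom), h2, IsIso.hom_inv_id_assoc, inj_coproductProj_self]
  rw [h3]
  infer_instance

theorem residueMatrixHom_lift
    (A : ∀ x : IsoClasses N, RowFiniteMatrix (IsoClassFiber N x) (ResidueRing (N x.out))) :
    residueMatrixHom hc hlocal (residueMatrixLift hc A) = A := by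
  refine funext fun x => RowFiniteMatrix.ext_row fun w => Finsupp.ext fun z => ?_
  obtain ⟨w, rfl⟩ := w
  refine (congrArg (residue _ z) ?_).trans (residue_residueLift _ z _)
  refine (Category.assoc _ _ _).symm.trans ?_
  change (c.inj w ≫ (residueMatrixLift hc A).hom) ≫ _ = _
  rw [inj_residueMatrixLift, Finsupp.sum, Preadditive.sum_comp]
  rw [Finset.sum_eq_single z]
  · rw [Category.assoc, inj_coproductProj_self, Category.comp_id]
  · intro y _ hy
    rw [Category.assoc, inj_coproductProj_of_ne hc fun h => hy (Subtype.ext h), comp_zero]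
  · intro hz
    -- Outside the support the sum has no term at `z`; this matches the lift because the class zero
    -- is represented by zero.
    rw [Finsupp.notMem_support_iff.1 hz, residueLift, ResidueRing.lift_zero]
    simp

/-- All but finitely many projections e_w lie in an open right ideal `V`. If the rows of `A` at the
exceptional `w` vanish, so do those of its lift `r`, hence every e_w r is in `V`, and so is their
sum `r`. -/
theorem tendsto_residueMatrixLift : Tendsto (residueMatrixLift hc) (𝓝 0) (𝓝 0) := by
  intro U hU
  obtain ⟨V, hVo, hVU, hV⟩ := RightTopologicalCategory.exists_open_submodule c.pt c.pt
    (EndOp.of ⁻¹' U) (continuous_op.continuousAt hU)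
  have hfin : {w | coproductProj hc w ≫ c.inj w ∉ V}.Finite := by
    have ht := tendsto_coproductProj_comp hc (𝟙 c.pt) c.inj (hVo.mem_nhds V.zero_mem)
    simp only [Category.id_comp] at ht
    exact ht
  refine mem_map.2 (RowFiniteMatrix.pi_mem_nhds_zero_iff.2
    ⟨hfin.toFinset.map ⟨fun w => ⟨Quotient.mk (isoSetoid N) w, w, rfl⟩, fun w w' h =>
      congrArg (fun p : Σ x, IsoClassFiber N x => (p.2 : Z)) h⟩, fun A hA => hVU ?_⟩)
  have hsum := hasSum_coproductProj_comp hc (𝟙 c.pt) (residueMatrixLift hc A).hom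
  rw [Category.id_comp] at hsum
  have := AddSubgroup.sub_sum_mem_of_hasSum hsum V hVo ∅ fun w _ => ?_
  · rwa [Finset.sum_empty, sub_zero] at this
  · rw [Category.id_comp]
    by_cases hw : coproductProj hc w ≫ c.inj w ∈ V
    · have := hV _ hw (residueMatrixLift hc A).hom
      rwa [Category.assoc] at this
    · have hrow := hA ⟨Quotient.mk (isoSetoid N) w, w, rfl⟩
        (Finset.mem_map.2 ⟨w, hfin.mem_toFinset.2 hw, rfl⟩)
      have hrow' : (A (Quotient.mk (isoSetoid N) w)).row ⟨w, rfl⟩ = 0 := hrow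
      rw [inj_residueMatrixLift, hrow', Finsupp.sum_zero_index, comp_zero]
      exact V.zero_mem

theorem hasSum_coproductIdempotent : HasSum (coproductIdempotent hc) 1 := by
  have := (hasSum_coproductProj_inj hc (𝟙 c.pt)).map (opAddEquiv : End c.pt ≃+ EndOp c.pt)
    continuous_op
  convert! this using 1
  funext w
  exact congrArg EndOp.of (Category.id_comp _).symm

/-- A nonzero class of e_w r means that row `w` of `r` has an invertible entry, and inverting that
entry recovers e_w. -/
theorem isSemisimpleModule_quotient_ker (M : Type v) [AddCommGroup M]
    [Module (EndOp c.pt ⧸ RingHom.ker (residueMatrixHom hc hlocal))ᵐᵒᵖ M]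
    (hM : IsDiscreteRightModule (EndOp c.pt ⧸ RingHom.ker (residueMatrixHom hc hlocal)) M) :
    IsSemisimpleModule (EndOp c.pt ⧸ RingHom.ker (residueMatrixHom hc hlocal))ᵐᵒᵖ M := by
  let q := Ideal.Quotient.mk (RingHom.ker (residueMatrixHom hc hlocal))
  have hq : Continuous q := (Ideal.Quotient.isOpenQuotientMap_mk _).continuous
  refine isSemisimpleModule_of_idempotents hM (fun w => q (coproductIdempotent hc w))
    (fun U hU => ?_) (fun w s hs => ?_)
  · have h1 : HasSum (fun w => q (coproductIdempotent hc w)) 1 := by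
      have := (hasSum_coproductIdempotent hc).map q hq
      rwa [map_one] at this
    have h2 : Tendsto (fun F : Finset Z => 1 - ∑ w ∈ F, q (coproductIdempotent hc w)) atTop
        (𝓝 0) := by
      have := (tendsto_const_nhds (x := (1 : EndOp c.pt ⧸ _))).sub h1
      rwa [sub_self] at this
    exact (h2.eventually_mem hU).exists
  · obtain ⟨r, rfl⟩ := Ideal.Quotient.mk_surjective s
    have h1 : coproductIdempotent hc w * r ∉ nonisoMatrices hc := fun h => hs (by
      rw [← map_mul]
      exact Ideal.Quotient.eq_zero_iff_mem.2 ((mem_ker_residueMatrixHom hc hlocal _).2 h))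
    obtain ⟨z, hz⟩ := exists_isIso_of_coproductIdempotent_mul hc hlocal h1
    obtain ⟨t, ht⟩ := exists_coproductIdempotent_mul_eq hc hz
    exact ⟨q t, by rw [← map_mul, ← map_mul, ht]⟩

end Matrices

end
theorem proposition6p4 {C : Type u} [Category.{v} C] [Preadditive C]
    [RightTopologicalCategory C] [IsTopologicallyAgreeable C]
    {Z : Type v} (N : Z → C) (c : Cofan N) (hc : IsColimit c)
    (hlocal : ∀ z, IsLocalRing (EndOp (N z))) :
    -- `End(M)ᵒᵖ` is identified with the set of all row-summable matrices
    Set.BijOn (matrixEntry hc) Set.univ {r | IsRowSummable r} ∧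
    -- the matrices of nonisomorphisms form a strongly closed two-sided ideal `I`
    ∃ (I : Ideal (EndOp c.pt)) (_ : I.IsTwoSided),
      (I : Set (EndOp c.pt)) = nonisoMatrices hc ∧
      IsStronglyClosed I.toAddSubgroup ∧
      -- the quotient ring is topologically semisimple in the quotient topology
      IsTopologicallySemisimple (EndOp c.pt ⧸ I) ∧
      -- the residue rings are skew-fields, and the quotient ring is isomorphic, as a topological
      -- ring, to a product of rings of row-finite matrices over them
      (∀ z, Nontrivial (ResidueRing (N z)) ∧
        ∀ a : ResidueRing (N z), a ≠ 0 → IsUnit a) ∧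
      ∃ e : (EndOp c.pt ⧸ I) ≃+*
          (∀ x : IsoClasses N, RowFiniteMatrix (IsoClassFiber N x) (ResidueRing (N x.out))),
        IsHomeomorph e := by
  have hcont := continuous_residueMatrixHom hc hlocal
  have hs := residueMatrixHom_lift hc hlocal
  have hs0 := tendsto_residueMatrixLift hc
  have hsurj : Function.Surjective (residueMatrixHom hc hlocal) := fun A => ⟨_, hs A⟩
  have he := isHomeomorph_quotientKerEquiv _ hcont (isOpenMap_of_section _ _ hs hs0) hsurj
  refine ⟨bijOn_matrixEntry hc, RingHom.ker (residueMatrixHom hc hlocal), inferInstance,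
    Set.ext (mem_ker_residueMatrixHom hc hlocal), isStronglyClosed_ker _ _ hcont hs hs0,
    ⟨⟨Ideal.Quotient.isTopologicalRing _,
      Ideal.Quotient.isLinearTopology_op _ (exists_open_right_ideal c.pt),
      isLinearlySeparated_of_isHomeomorph _ he, isLinearlyComplete_of_isHomeomorph _ he⟩,
      fun M _ _ hM => isSemisimpleModule_quotient_ker hc hlocal M hM⟩,
    fun z => ResidueRing.nontrivial_and_isUnit (hlocal z), _, he⟩
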